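/- Let $p$ be a prime number and let $u \ge 0$ be an integer. Let $\mathcal{G}_p$ be the set of isomorphism classes of finite abelian $p$-groups (including the trivial group), and for $G \in \mathcal{G}_p$ let $|G|$ denote its order and $|\mathrm{Aut}(G)|$ the number of its group automorphisms. Then the series and the infinite product below converge, and $$\sum_{G\in\mathcal{G}_p}\frac{1}{|G|^u\cdot |\mathrm{Aut}(G)|}=\prod_{j=u+1}^\infty\left(1-\frac{1}{p^j}\right)^{-1}.$$ -/

import Mathlib

universe v

/-- A finite abelian `p`-group, written multiplicatively (the trivial group is one of them). -/
structure FinAbPGroup (p : ℕ) : Type (v + 1) where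
  carrier : Type v
  [group : CommGroup carrier]
  [finite : Finite carrier]
  isPGroup : IsPGroup p carrier

attribute [instance] FinAbPGroup.group FinAbPGroup.finite

/-- Two finite abelian `p`-groups are equivalent when they are isomorphic as groups. -/
instance FinAbPGroup.isoSetoid (p : ℕ) : Setoid (FinAbPGroup.{v} p) where
  r G H := Nonempty (G.carrier ≃* H.carrier)
  iseqv :=
    { refl := fun G => ⟨MulEquiv.refl G.carrier⟩
      symm := fun ⟨e⟩ => ⟨e.symm⟩
      trans := fun ⟨e⟩ ⟨f⟩ => ⟨e.trans f⟩ }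

/-- The collection of isomorphism classes of finite abelian `p`-groups. -/
def FinAbPGroupClass (p : ℕ) : Type (v + 1) :=
  Quotient (FinAbPGroup.isoSetoid.{v} p)

/-- The order `|G|` of (any representative of) an isomorphism class. -/
noncomputable def FinAbPGroupClass.order {p : ℕ} (G : FinAbPGroupClass.{v} p) : ℕ :=
  Quotient.lift (s := FinAbPGroup.isoSetoid.{v} p) (fun H : FinAbPGroup.{v} p => Nat.card H.carrier)
    (fun _ _ ⟨e⟩ => Nat.card_congr e.toEquiv) G

/-- The number `|Aut(G)|` of automorphisms of (any representative of) an isomorphism class. -/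
noncomputable def FinAbPGroupClass.cardAut {p : ℕ} (G : FinAbPGroupClass.{v} p) : ℕ :=
  Quotient.lift (s := FinAbPGroup.isoSetoid.{v} p) (fun H : FinAbPGroup.{v} p => Nat.card (MulAut H.carrier))
    (fun _ _ ⟨e⟩ => Nat.card_congr (MulAut.congr e).toEquiv) G

/-! Count the subgroups of `ℤ ^ k` of `p`-power index, weighted by `index ^ (-s)` with `s = k + u`,
in two ways. Goursat's description of the subgroups of `ℤ × M` splits off one factor `(1 - p ^ (i -
s))⁻¹` per coordinate (`subgroupZeta_int_prod`), so the count is the product over `j` from `u + 1`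
to `u + k`. Grouping subgroups by the class `G` of the quotient gives `#Sur(ℤ ^ k, G) / |Aut G|`
subgroups for each `G`, hence the sum of `1 / (|G| ^ u |Aut G|)` times the proportion of surjections
among homomorphisms `ℤ ^ k → G` (`tsum_surjectiveDensity`). That proportion is at most 1 and tends
to 1, so `k → ∞` gives the identity. Working in `ℝ≥0∞` makes every rearrangement free. -/

open Filter Topology
open scoped ENNReal

/-! ### Goursat's description of the subgroups of a product -/

/-- The subgroup of `A × M` attached to `N ≤ A`, `H ≤ M` and `φ : H →+ A ⧸ N`: the pairs `(a, m)`
with `m ∈ H` and `φ m = a mod N`. -/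
def AddSubgroup.ofGoursat {A M : Type*} [AddCommGroup A] [AddCommGroup M]
    (x : Σ q : AddSubgroup A × AddSubgroup M, (q.2 →+ A ⧸ q.1)) : AddSubgroup (A × M) where
  carrier := {z | ∃ h : z.2 ∈ x.1.2, x.2 ⟨z.2, h⟩ = (z.1 : A ⧸ x.1.1)}
  zero_mem' := ⟨x.1.2.zero_mem, x.2.map_zero⟩
  add_mem' := by
    rintro ⟨a, m⟩ ⟨b, n⟩ ⟨h, e⟩ ⟨h', e'⟩
    refine ⟨x.1.2.add_mem h h', ?_⟩
    have := x.2.map_add ⟨m, h⟩ ⟨n, h'⟩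
    rw [e, e'] at this
    exact this
  neg_mem' := by
    rintro ⟨a, m⟩ ⟨h, e⟩
    refine ⟨x.1.2.neg_mem h, ?_⟩
    have := x.2.map_neg ⟨m, h⟩
    rw [e] at this
    exact this

namespace AddSubgroup

variable {A M : Type*} [AddCommGroup A] [AddCommGroup M]

theorem mem_ofGoursat {x : Σ q : AddSubgroup A × AddSubgroup M, (q.2 →+ A ⧸ q.1)} {z : A × M} :
    z ∈ ofGoursat x ↔ ∃ h : z.2 ∈ x.1.2, x.2 ⟨z.2, h⟩ = (z.1 : A ⧸ x.1.1) := Iff.rfl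

theorem comap_inl_ofGoursat (x : Σ q : AddSubgroup A × AddSubgroup M, (q.2 →+ A ⧸ q.1)) :
    (ofGoursat x).comap (AddMonoidHom.inl A M) = x.1.1 := by
  ext a
  refine Iff.trans ?_ (QuotientAddGroup.eq_zero_iff a)
  constructor
  · rintro ⟨h, e⟩
    exact e.symm.trans x.2.map_zero
  · intro h
    exact ⟨x.1.2.zero_mem, x.2.map_zero.trans h.symm⟩

theorem map_snd_ofGoursat (x : Σ q : AddSubgroup A × AddSubgroup M, (q.2 →+ A ⧸ q.1)) :
    (ofGoursat x).map (AddMonoidHom.snd A M) = x.1.2 := by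
  ext m
  rw [mem_map]
  constructor
  · rintro ⟨z, ⟨h, -⟩, rfl⟩
    exact h
  · intro h
    obtain ⟨a, ha⟩ := QuotientAddGroup.mk_surjective (x.2 ⟨m, h⟩)
    exact ⟨(a, m), ⟨h, ha.symm⟩, rfl⟩

theorem ofGoursat_injective : Function.Injective (ofGoursat (A := A) (M := M)) := by
  rintro x y hxy
  have h1 : x.1.1 = y.1.1 := by rw [← comap_inl_ofGoursat, hxy, comap_inl_ofGoursat]
  have h2 : x.1.2 = y.1.2 := by rw [← map_snd_ofGoursat, hxy, map_snd_ofGoursat]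
  obtain ⟨⟨N, H⟩, φ⟩ := x
  obtain ⟨⟨N', H'⟩, ψ⟩ := y
  obtain rfl : N = N' := h1
  obtain rfl : H = H' := h2
  suffices φ = ψ by rw [this]
  ext ⟨m, h⟩
  obtain ⟨a, ha⟩ := QuotientAddGroup.mk_surjective (φ ⟨m, h⟩)
  have : (a, m) ∈ ofGoursat ⟨(N, H), φ⟩ := ⟨h, ha.symm⟩
  rw [hxy] at this
  obtain ⟨h', e⟩ := this
  exact ha.symm.trans e.symm

/-- Take `N = L ∩ A` and `H` the projection of `L` to `M`; send `m` to the class of any `a` with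
`(a, m) ∈ L`. Two choices of `a` differ by an element of `N`. -/
theorem ofGoursat_surjective : Function.Surjective (ofGoursat (A := A) (M := M)) := by
  intro L
  let N := L.comap (AddMonoidHom.inl A M)
  let q : L →+ L.map (AddMonoidHom.snd A M) := (AddMonoidHom.snd A M).addSubgroupMap L
  have hq : Function.Surjective q := (AddMonoidHom.snd A M).addSubgroupMap_surjective L
  let g : L →+ A ⧸ N := (QuotientAddGroup.mk' N).comp ((AddMonoidHom.fst A M).comp L.subtype)
  have hker : q.ker ≤ g.ker := by
    rintro ⟨⟨a, m⟩, hL⟩ h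
    have hm : m = 0 := congrArg Subtype.val h
    subst hm
    exact (QuotientAddGroup.eq_zero_iff a).2 hL
  have hlift (z : L) : q.liftOfSurjective hq ⟨g, hker⟩ (q z) = g z :=
    AddMonoidHom.liftOfRightInverse_comp_apply _ _ _ ⟨g, hker⟩ z
  refine ⟨⟨(N, L.map (AddMonoidHom.snd A M)), q.liftOfSurjective hq ⟨g, hker⟩⟩, ?_⟩
  ext ⟨a, m⟩
  constructor
  · rintro ⟨⟨⟨b, m'⟩, hb, hm⟩, e⟩
    obtain rfl : m' = m := hm
    have h1 := (hlift ⟨(b, m'), hb⟩).symm.trans e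
    have h2 : -b + a ∈ N := QuotientAddGroup.eq.1 h1
    have h3 : ((-b + a, 0) : A × M) ∈ L := h2
    have := L.add_mem hb h3
    simpa using this
  · intro h
    exact ⟨⟨(a, m), h, rfl⟩, hlift ⟨(a, m), h⟩⟩

theorem ofGoursat_bijective : Function.Bijective (ofGoursat (A := A) (M := M)) :=
  ⟨ofGoursat_injective, ofGoursat_surjective⟩

/-- Insert `L + A` between `L` and `A × M`: the lower step has index `[A : L ∩ A]`, the upper one
the index of the projection. -/
theorem index_eq_comap_inl_mul_map_snd (L : AddSubgroup (A × M)) :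
    L.index = (L.comap (AddMonoidHom.inl A M)).index * (L.map (AddMonoidHom.snd A M)).index := by
  have hr : (AddMonoidHom.inl A M).range = (AddMonoidHom.snd A M).ker := by
    ext ⟨a, m⟩
    simp only [AddMonoidHom.mem_range, AddMonoidHom.mem_ker, AddMonoidHom.inl_apply,
      AddMonoidHom.coe_snd, Prod.mk.injEq]
    exact ⟨fun ⟨_, _, h⟩ => h.symm, fun h => ⟨a, rfl, h.symm⟩⟩
  have hs : (AddMonoidHom.snd A M).range = ⊤ := AddMonoidHom.range_eq_top.2 Prod.snd_surjective
  rw [index_comap, index_map,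
    hs, index_top, mul_one,
    hr, ← relIndex_sup_left, relIndex_mul_index le_sup_left]

end AddSubgroup

/-! ### Homomorphisms out of finite-index subgroups of free abelian groups -/

theorem Nat.card_addMonoidHom_of_free (M A : Type*) [AddCommGroup M] [AddCommGroup A]
    [Module.Free ℤ M] [Module.Finite ℤ M] :
    Nat.card (M →+ A) = Nat.card A ^ Module.finrank ℤ M := by
  let b := Module.finBasis ℤ M
  rw [Nat.card_congr ((addMonoidHomLequivInt ℤ).toEquiv.trans (b.constr ℤ).symm.toEquiv),
    Nat.card_fun, Nat.card_fin]

/-- The quotient is killed by the index, hence torsion, hence of rank zero. -/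
theorem AddSubgroup.finrank_eq_of_index_ne_zero {M : Type*} [AddCommGroup M] [Module.Finite ℤ M]
    (H : AddSubgroup M) (hH : H.index ≠ 0) :
    Module.finrank ℤ H = Module.finrank ℤ M := by
  have h := Submodule.finrank_quotient_add_finrank (AddSubgroup.toIntSubmodule H)
  have h0 : Module.finrank ℤ (M ⧸ AddSubgroup.toIntSubmodule H) = 0 := by
    rw [Module.finrank_eq_zero_iff_isTorsion]
    intro x
    refine ⟨⟨(H.index : ℤ), mem_nonZeroDivisors_of_ne_zero (by exact_mod_cast hH)⟩, ?_⟩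
    obtain ⟨m, rfl⟩ := Submodule.Quotient.mk_surjective _ x
    rw [Submonoid.mk_smul, ← Submodule.Quotient.mk_smul, Submodule.Quotient.mk_eq_zero]
    rw [Nat.cast_smul_eq_nsmul]
    exact H.nsmul_index_mem m
  rw [h0, zero_add] at h
  exact h

theorem AddSubgroup.card_addMonoidHom {M : Type*} [AddCommGroup M] [Module.Free ℤ M]
    [Module.Finite ℤ M] (A : Type*) [AddCommGroup A] (H : AddSubgroup M) (hH : H.index ≠ 0) :
    Nat.card (H →+ A) = Nat.card A ^ Module.finrank ℤ M := by
  have : Module.Free ℤ H := inferInstanceAs (Module.Free ℤ (AddSubgroup.toIntSubmodule H))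
  have : Module.Finite ℤ H := inferInstanceAs (Module.Finite ℤ (AddSubgroup.toIntSubmodule H))
  rw [Nat.card_addMonoidHom_of_free, H.finrank_eq_of_index_ne_zero hH]

/-! ### The subgroup zeta function of `ℤ ^ k` -/

open Classical in
/-- `n ^ (-s)` if `n` is a power of `p`, and zero otherwise. -/
noncomputable def primePowWeight (p s n : ℕ) : ℝ≥0∞ :=
  if ∃ a, n = p ^ a then (n : ℝ≥0∞)⁻¹ ^ s else 0

theorem primePowWeight_pow (p s a : ℕ) :
    primePowWeight p s (p ^ a) = ((p : ℝ≥0∞)⁻¹ ^ s) ^ a := by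
  rw [primePowWeight, if_pos ⟨a, rfl⟩, Nat.cast_pow, ENNReal.inv_pow, ← pow_mul, ← pow_mul,
    mul_comm]

theorem primePowWeight_of_not {p s n : ℕ} (h : ¬ ∃ a, n = p ^ a) : primePowWeight p s n = 0 :=
  if_neg h

theorem primePowWeight_mul {p : ℕ} (hp : p.Prime) (s m n : ℕ) :
    primePowWeight p s (m * n) = primePowWeight p s m * primePowWeight p s n := by
  by_cases hm : ∃ a, m = p ^ a
  · by_cases hn : ∃ b, n = p ^ b
    · obtain ⟨a, rfl⟩ := hm
      obtain ⟨b, rfl⟩ := hn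
      rw [← pow_add, primePowWeight_pow, primePowWeight_pow, primePowWeight_pow, pow_add]
    · rw [primePowWeight_of_not hn, mul_zero, primePowWeight_of_not]
      rintro ⟨c, hc⟩
      obtain ⟨b, -, hb⟩ := (Nat.dvd_prime_pow hp).1 (Dvd.intro_left m hc)
      exact hn ⟨b, hb⟩
  · rw [primePowWeight_of_not hm, zero_mul, primePowWeight_of_not]
    rintro ⟨c, hc⟩
    obtain ⟨b, -, hb⟩ := (Nat.dvd_prime_pow hp).1 (Dvd.intro n hc)
    exact hm ⟨b, hb⟩

/-- The `p`-part of the subgroup zeta function of `M`, at `s`. -/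
noncomputable def subgroupZeta (p s : ℕ) (M : Type*) [AddCommGroup M] : ℝ≥0∞ :=
  ∑' H : AddSubgroup M, primePowWeight p s H.index

theorem subgroupZeta_congr (p s : ℕ) {M M' : Type*} [AddCommGroup M] [AddCommGroup M']
    (e : M ≃+ M') : subgroupZeta p s M = subgroupZeta p s M' := by
  rw [subgroupZeta, subgroupZeta, ← e.mapAddSubgroup.toEquiv.tsum_eq]
  refine tsum_congr fun H => ?_
  congr 1
  exact (AddSubgroup.index_map_equiv H e).symm

/-- The subgroups that contribute are `p ^ a ℤ`, giving a geometric series. For `k ≥ s` both sides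
are `∞`, the subtraction being truncated. -/
theorem tsum_addSubgroup_int {p : ℕ} (hp : p.Prime) (s k : ℕ) :
    ∑' N : AddSubgroup ℤ, primePowWeight p s N.index * (N.index : ℝ≥0∞) ^ k =
      (1 - (p : ℝ≥0∞) ^ k * (p : ℝ≥0∞)⁻¹ ^ s)⁻¹ := by
  have hidx (a : ℕ) : (AddSubgroup.zmultiples ((p ^ a : ℕ) : ℤ)).index = p ^ a := by
    rw [Int.index_zmultiples, Int.natAbs_natCast]
  have hinj : Function.Injective fun a : ℕ => AddSubgroup.zmultiples ((p ^ a : ℕ) : ℤ) := by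
    intro a b h
    have := congrArg AddSubgroup.index h
    simp only [hidx] at this
    exact Nat.pow_right_injective hp.two_le this
  rw [← ENNReal.tsum_geometric, ← hinj.tsum_eq]
  · refine tsum_congr fun a => ?_
    simp only [hidx]
    rw [primePowWeight_pow, Nat.cast_pow, mul_pow, mul_comm, ← pow_mul (p : ℝ≥0∞), mul_comm a k,
      pow_mul]
  · intro N hN
    obtain ⟨a, ha⟩ : ∃ a, N.index = p ^ a := by
      by_contra h
      exact hN (by simp only [primePowWeight_of_not h, zero_mul])
    obtain ⟨g, hg⟩ := Int.subgroup_cyclic N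
    rw [← AddSubgroup.zmultiples_eq_closure] at hg
    refine ⟨a, ?_⟩
    rw [hg, Int.index_zmultiples] at ha
    simp only [hg]
    rw [← ha, Int.zmultiples_natAbs]

/-- Each pair `(N, H)` of nonzero weight carries `|ℤ ⧸ N| ^ rank M` homomorphisms, a number
independent of `H`, so the double sum factors. -/
theorem subgroupZeta_int_prod {p : ℕ} (hp : p.Prime) (s : ℕ) (M : Type*) [AddCommGroup M]
    [Module.Free ℤ M] [Module.Finite ℤ M] :
    subgroupZeta p s (ℤ × M) =
      (1 - (p : ℝ≥0∞) ^ Module.finrank ℤ M * (p : ℝ≥0∞)⁻¹ ^ s)⁻¹ * subgroupZeta p s M := by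
  rw [← tsum_addSubgroup_int hp, subgroupZeta, subgroupZeta, ← ENNReal.tsum_mul_right,
    ← (Equiv.ofBijective _ AddSubgroup.ofGoursat_bijective).tsum_eq, ENNReal.tsum_sigma']
  simp_rw [← ENNReal.tsum_mul_left]
  rw [← ENNReal.tsum_prod]
  refine tsum_congr fun ⟨N, H⟩ => ?_
  have hw (φ : H →+ ℤ ⧸ N) :
      primePowWeight p s (AddSubgroup.ofGoursat ⟨(N, H), φ⟩).index =
        primePowWeight p s N.index * primePowWeight p s H.index := by
    rw [AddSubgroup.index_eq_comap_inl_mul_map_snd, AddSubgroup.comap_inl_ofGoursat,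
      AddSubgroup.map_snd_ofGoursat, primePowWeight_mul hp]
  simp only [Equiv.ofBijective_apply, hw, ENNReal.tsum_const]
  -- If either index is not a power of `p`, both sides vanish, even when there are infinitely many
  -- `φ`.
  by_cases hN : ∃ a, N.index = p ^ a
  swap
  · simp [primePowWeight_of_not hN]
  by_cases hH : ∃ a, H.index = p ^ a
  swap
  · simp [primePowWeight_of_not hH]
  have hN0 : N.index ≠ 0 := by
    obtain ⟨a, ha⟩ := hN
    rw [ha]
    exact pow_ne_zero _ hp.ne_zero
  have hH0 : H.index ≠ 0 := by
    obtain ⟨a, ha⟩ := hH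
    rw [ha]
    exact pow_ne_zero _ hp.ne_zero
  have hcard := H.card_addMonoidHom (ℤ ⧸ N) hH0
  have : Finite (H →+ ℤ ⧸ N) := Nat.finite_of_card_ne_zero (by
    rw [hcard]
    exact pow_ne_zero _ hN0)
  rw [ENat.card_eq_coe_natCard, hcard]
  change (((N.index ^ _ : ℕ) : ℕ∞) : ℝ≥0∞) * _ = _
  push_cast
  ring

theorem subgroupZeta_pi_int {p : ℕ} (hp : p.Prime) (s k : ℕ) :
    subgroupZeta p s (Fin k → ℤ) =
      ∏ i ∈ Finset.range k, (1 - (p : ℝ≥0∞) ^ i * (p : ℝ≥0∞)⁻¹ ^ s)⁻¹ := by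
  induction k with
  | zero =>
    rw [Finset.prod_range_zero, subgroupZeta, tsum_eq_single ⊤ fun H hH => (hH ?_).elim]
    · simpa using primePowWeight_pow p s 0
    · exact Subsingleton.elim _ _
  | succ k ih =>
    rw [← subgroupZeta_congr p s (Fin.consLinearEquiv ℤ fun _ : Fin (k + 1) => ℤ).toAddEquiv,
      subgroupZeta_int_prod hp, ih, Finset.prod_range_succ, Module.finrank_fin_fun, mul_comm]

/-! ### Surjections from `ℤ ^ k` onto a finite group -/

namespace AddMonoidHom

variable {M A : Type*} [AddCommGroup M] [AddCommGroup A]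

/-- Surjective homomorphisms `M → A` are the pairs of a kernel and an isomorphism of the
quotient with `A`. -/
noncomputable def sigmaQuotientEquivSurjective (M A : Type*) [AddCommGroup M] [AddCommGroup A] :
    (Σ H : {H : AddSubgroup M // Nonempty (M ⧸ H ≃+ A)}, (M ⧸ H.1 ≃+ A)) ≃
      {f : M →+ A // Function.Surjective f} :=
  Equiv.ofBijective
    (fun x => ⟨(x.2 : M ⧸ x.1.1 →+ A).comp (QuotientAddGroup.mk' x.1.1),
      x.2.surjective.comp (QuotientAddGroup.mk'_surjective _)⟩) <| by
    constructor
    · rintro ⟨⟨H, hH⟩, e⟩ ⟨⟨H', hH'⟩, e'⟩ h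
      have h1 (m : M) : e (m : M ⧸ H) = e' (m : M ⧸ H') :=
        DFunLike.congr_fun (congrArg Subtype.val h) m
      obtain rfl : H = H' := by
        ext m
        rw [← QuotientAddGroup.eq_zero_iff, ← e.map_eq_zero_iff, h1, e'.map_eq_zero_iff,
          QuotientAddGroup.eq_zero_iff]
      suffices e = e' by rw [this]
      ext x
      obtain ⟨m, rfl⟩ := QuotientAddGroup.mk_surjective x
      exact h1 m
    · rintro ⟨f, hf⟩
      refine ⟨⟨⟨f.ker, ⟨QuotientAddGroup.quotientKerEquivOfSurjective f hf⟩⟩,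
        QuotientAddGroup.quotientKerEquivOfSurjective f hf⟩, ?_⟩
      ext m
      rfl

theorem card_surjective_eq (M A : Type*) [AddCommGroup M] [AddCommGroup A] :
    Nat.card {f : M →+ A // Function.Surjective f} =
      Nat.card {H : AddSubgroup M // Nonempty (M ⧸ H ≃+ A)} * Nat.card (A ≃+ A) := by
  rw [← Nat.card_prod, ← Nat.card_congr (sigmaQuotientEquivSurjective M A)]
  -- A chosen isomorphism for each admissible kernel identifies all the others with automorphisms of
  -- `A`.
  refine Nat.card_congr ((Equiv.sigmaCongrRight fun H => ?_).trans (Equiv.sigmaEquivProd _ _))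
  exact
    { toFun := fun e => H.2.some.symm.trans e
      invFun := fun e => H.2.some.trans e
      left_inv := fun e => by ext; simp
      right_inv := fun e => by ext; simp }

theorem card_pi_int (A : Type*) [AddCommGroup A] (k : ℕ) :
    Nat.card ((Fin k → ℤ) →+ A) = Nat.card A ^ k := by
  rw [Nat.card_addMonoidHom_of_free, Module.finrank_fin_fun]

theorem finite_pi_int (A : Type*) [AddCommGroup A] [Finite A] (k : ℕ) :
    Finite ((Fin k → ℤ) →+ A) :=
  Nat.finite_of_card_ne_zero (by
    rw [card_pi_int]
    exact pow_ne_zero _ Nat.card_pos.ne')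

end AddMonoidHom

/-- Union bound: a non-surjective function misses some `a`, and `(|A| - 1) ^ |ι|` functions miss a
given `a`. -/
theorem Function.card_pow_le_card_surjective_add (ι A : Type*) [Finite ι] [Finite A] :
    Nat.card A ^ Nat.card ι ≤ Nat.card {f : ι → A // Function.Surjective f} +
      Nat.card A * (Nat.card A - 1) ^ Nat.card ι := by
  classical
  have h1 := Nat.card_congr (Equiv.sumCompl fun f : ι → A => Function.Surjective f)
  rw [Nat.card_sum, Nat.card_fun] at h1
  rw [← h1]
  refine Nat.add_le_add_left ?_ _
  have h2 : Nat.card (Σ a : A, (ι → {b : A // b ≠ a})) =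
      Nat.card A * (Nat.card A - 1) ^ Nat.card ι := by
    have := Fintype.ofFinite A
    rw [Nat.card_sigma]
    have h (a : A) : Nat.card (ι → {b : A // b ≠ a}) = (Nat.card A - 1) ^ Nat.card ι := by
      rw [Nat.card_fun, Nat.card_eq_fintype_card (α := A), Nat.card_eq_fintype_card,
        Fintype.card_subtype_compl, Fintype.card_subtype_eq]
    rw [Finset.sum_congr rfl fun a _ => h a, Finset.sum_const, Finset.card_univ, smul_eq_mul,
      Nat.card_eq_fintype_card (α := A)]
  rw [← h2]
  have hex (f : {f : ι → A // ¬ Function.Surjective f}) : ∃ a, ∀ i, f.1 i ≠ a := by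
    simpa [Function.Surjective] using f.2
  choose a ha using hex
  refine Nat.card_le_card_of_injective
    (fun f => (⟨a f, fun i => ⟨f.1 i, ha f i⟩⟩ : Σ a : A, (ι → {b : A // b ≠ a}))) ?_
  intro f g h
  exact Subtype.ext
    (congrArg (fun (x : Σ a : A, (ι → {b : A // b ≠ a})) (i : ι) => (x.2 i : A)) h)

namespace AddMonoidHom

variable (A : Type*) [AddCommGroup A] [Finite A]

/-- A function on the basis that already hits all of `A` extends to a surjective homomorphism. -/
theorem card_pow_le_card_surjective_add (k : ℕ) :
    Nat.card A ^ k ≤ Nat.card {f : (Fin k → ℤ) →+ A // Function.Surjective f} +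
      Nat.card A * (Nat.card A - 1) ^ k := by
  have := finite_pi_int A k
  have h := Function.card_pow_le_card_surjective_add (Fin k) A
  rw [Nat.card_fin] at h
  refine h.trans (Nat.add_le_add_right ?_ _)
  let b := Pi.basisFun ℤ (Fin k)
  have hb (f : Fin k → A) (i : Fin k) : b.constr ℤ f (b i) = f i := b.constr_basis ℤ f i
  refine Nat.card_le_card_of_injective
    (fun f => ⟨(b.constr ℤ f.1).toAddMonoidHom, fun a => ?_⟩) fun f g hfg => ?_
  · obtain ⟨i, rfl⟩ := f.2 a
    exact ⟨b i, hb f.1 i⟩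
  · ext i
    rw [← hb f.1, ← hb g.1]
    exact DFunLike.congr_fun (congrArg Subtype.val hfg) (b i)

/-- The proportion of surjective maps among all homomorphisms `ℤ ^ k → A`. -/
noncomputable def surjectiveDensity (k : ℕ) : ℝ≥0∞ :=
  (Nat.card {f : (Fin k → ℤ) →+ A // Function.Surjective f} : ℝ≥0∞) * (Nat.card A : ℝ≥0∞)⁻¹ ^ k

theorem surjectiveDensity_le_one (k : ℕ) : surjectiveDensity A k ≤ 1 := by
  have := finite_pi_int A k
  have h := Finite.card_subtype_le fun f : (Fin k → ℤ) →+ A => Function.Surjective f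
  rw [card_pi_int] at h
  have h0 : (Nat.card A : ℝ≥0∞) ≠ 0 := Nat.cast_ne_zero.2 Nat.card_pos.ne'
  calc surjectiveDensity A k
      ≤ ((Nat.card A ^ k : ℕ) : ℝ≥0∞) * (Nat.card A : ℝ≥0∞)⁻¹ ^ k := by
        unfold surjectiveDensity
        gcongr
    _ = 1 := by
        rw [Nat.cast_pow, ← mul_pow, ENNReal.mul_inv_cancel h0 (ENNReal.natCast_ne_top _), one_pow]

theorem tendsto_surjectiveDensity : Tendsto (surjectiveDensity A) atTop (𝓝 1) := by
  have hpos : 0 < Nat.card A := Nat.card_pos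
  have h0 : (Nat.card A : ℝ≥0∞) ≠ 0 := Nat.cast_ne_zero.2 hpos.ne'
  have ht : (Nat.card A : ℝ≥0∞) ≠ ∞ := ENNReal.natCast_ne_top _
  -- By the union bound the density is at least `1 - |A| r ^ k` with `r = (|A| - 1) / |A| < 1`.
  set r : ℝ≥0∞ := ((Nat.card A - 1 : ℕ) : ℝ≥0∞) * (Nat.card A : ℝ≥0∞)⁻¹ with hr
  have hr1 : r < 1 := by
    rw [hr, ← div_eq_mul_inv, ENNReal.div_lt_iff (Or.inl h0) (Or.inl ht), one_mul]
    exact_mod_cast Nat.sub_lt hpos one_pos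
  have hlim : Tendsto (fun k => 1 - (Nat.card A : ℝ≥0∞) * r ^ k) atTop (𝓝 1) := by
    have h1 := ENNReal.Tendsto.const_mul (ENNReal.tendsto_pow_atTop_nhds_zero_of_lt_one hr1)
      (Or.inr ht)
    have h2 := ENNReal.Tendsto.sub (tendsto_const_nhds (x := (1 : ℝ≥0∞)) (f := atTop)) h1
      (Or.inl ENNReal.one_ne_top)
    simpa using h2
  refine tendsto_of_tendsto_of_tendsto_of_le_of_le hlim tendsto_const_nhds (fun k => ?_)
    (surjectiveDensity_le_one A)
  rw [tsub_le_iff_right]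
  calc (1 : ℝ≥0∞) = ((Nat.card A ^ k : ℕ) : ℝ≥0∞) * (Nat.card A : ℝ≥0∞)⁻¹ ^ k := by
        rw [Nat.cast_pow, ← mul_pow, ENNReal.mul_inv_cancel h0 ht, one_pow]
    _ ≤ ((Nat.card {f : (Fin k → ℤ) →+ A // Function.Surjective f} +
          Nat.card A * (Nat.card A - 1) ^ k : ℕ) : ℝ≥0∞) * (Nat.card A : ℝ≥0∞)⁻¹ ^ k := by
        gcongr
        exact card_pow_le_card_surjective_add A k
    _ = surjectiveDensity A k + (Nat.card A : ℝ≥0∞) * r ^ k := by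
        rw [surjectiveDensity, hr, mul_pow]
        push_cast
        ring

end AddMonoidHom

/-! ### Isomorphism classes as quotients -/

namespace FinAbPGroupClass

variable {p : ℕ}

/-- A representative of an isomorphism class, written additively. -/
abbrev Rep (G : FinAbPGroupClass.{v} p) : Type v :=
  Additive (Quotient.out (s := FinAbPGroup.isoSetoid.{v} p) G).carrier

theorem order_eq_card_rep (G : FinAbPGroupClass.{v} p) : G.order = Nat.card G.Rep := by
  conv_lhs => rw [← Quotient.out_eq (s := FinAbPGroup.isoSetoid.{v} p) G]
  rfl

theorem cardAut_eq_card_rep (G : FinAbPGroupClass.{v} p) :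
    G.cardAut = Nat.card (G.Rep ≃+ G.Rep) := by
  conv_lhs => rw [← Quotient.out_eq (s := FinAbPGroup.isoSetoid.{v} p) G]
  exact Nat.card_congr MulEquiv.toAdditive

theorem order_pos (G : FinAbPGroupClass.{v} p) : 0 < G.order := by
  rw [order_eq_card_rep]
  exact Nat.card_pos

theorem cardAut_pos (G : FinAbPGroupClass.{v} p) : 0 < G.cardAut := by
  rw [cardAut_eq_card_rep]
  have : Finite (G.Rep ≃+ G.Rep) :=
    Finite.of_injective (fun e => (e : G.Rep → G.Rep)) DFunLike.coe_injective
  exact Nat.card_pos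

theorem exists_order_eq_pow (hp : p.Prime) (G : FinAbPGroupClass.{v} p) :
    ∃ a, G.order = p ^ a := by
  have := Fact.mk hp
  rw [order_eq_card_rep]
  let R := Quotient.out (s := FinAbPGroup.isoSetoid.{v} p) G
  exact (IsPGroup.iff_card (G := R.carrier)).1 R.isPGroup

/-- The isomorphism class of `M ⧸ H` for a subgroup `H` of `p`-power index. -/
noncomputable def ofQuotient {M : Type} [AddCommGroup M] (hp : p.Prime)
    (H : {H : AddSubgroup M // ∃ a, H.index = p ^ a}) : FinAbPGroupClass.{v} p :=
  have hfin : Finite (M ⧸ H.1) := Nat.finite_of_card_ne_zero (by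
    obtain ⟨a, ha⟩ := H.2
    change H.1.index ≠ 0
    rw [ha]
    exact pow_ne_zero _ hp.ne_zero)
  Quotient.mk (FinAbPGroup.isoSetoid.{v} p)
    -- `M` lives in `Type`, while the classes live over an arbitrary universe `v`; hence the
    -- `ULift`.
    { carrier := Multiplicative (ULift.{v} (M ⧸ H.1))
      isPGroup := by
        obtain ⟨a, ha⟩ := H.2
        refine IsPGroup.of_card (n := a) ?_
        rw [← ha]
        exact Nat.card_congr Equiv.ulift }

theorem ofQuotient_eq_iff {M : Type} [AddCommGroup M] (hp : p.Prime)
    (H : {H : AddSubgroup M // ∃ a, H.index = p ^ a}) (G : FinAbPGroupClass.{v} p) :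
    ofQuotient hp H = G ↔ Nonempty (M ⧸ H.1 ≃+ G.Rep) := by
  conv_lhs => rw [← Quotient.out_eq (s := FinAbPGroup.isoSetoid.{v} p) G]
  refine (Quotient.eq (r := FinAbPGroup.isoSetoid.{v} p)).trans ?_
  constructor
  · rintro ⟨e⟩
    exact ⟨AddEquiv.ulift.symm.trans (MulEquiv.toAdditive e)⟩
  · rintro ⟨e⟩
    exact ⟨MulEquiv.toAdditive.symm (AddEquiv.ulift.trans e)⟩

/-- The fibre of `ofQuotient` over `G`. -/
noncomputable def ofQuotientFiberEquiv {M : Type} [AddCommGroup M] (hp : p.Prime)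
    (G : FinAbPGroupClass.{v} p) :
    {H : {H : AddSubgroup M // ∃ a, H.index = p ^ a} // ofQuotient hp H = G} ≃
      {H : AddSubgroup M // Nonempty (M ⧸ H ≃+ G.Rep)} where
  toFun H := ⟨H.1.1, (ofQuotient_eq_iff hp H.1 G).1 H.2⟩
  invFun H :=
    have hH : ∃ a, H.1.index = p ^ a := by
      obtain ⟨e⟩ := H.2
      obtain ⟨a, ha⟩ := G.exists_order_eq_pow hp
      exact ⟨a, (Nat.card_congr e.toEquiv).trans (G.order_eq_card_rep.symm.trans ha)⟩
    ⟨⟨H.1, hH⟩, (ofQuotient_eq_iff hp ⟨H.1, hH⟩ G).2 H.2⟩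
  left_inv _ := rfl
  right_inv _ := rfl

end FinAbPGroupClass

/-! ### Comparison of the two counts -/

open FinAbPGroupClass in
theorem subgroupZeta_eq_tsum_class {p : ℕ} (hp : p.Prime) (s : ℕ) (M : Type) [AddCommGroup M] :
    subgroupZeta p s M = ∑' G : FinAbPGroupClass.{v} p,
      (ENat.card {H : AddSubgroup M // Nonempty (M ⧸ H ≃+ G.Rep)} : ℝ≥0∞) *
        (G.order : ℝ≥0∞)⁻¹ ^ s := by
  have h1 : subgroupZeta p s M =
      ∑' H : {H : AddSubgroup M // ∃ a, H.index = p ^ a}, (H.1.index : ℝ≥0∞)⁻¹ ^ s := by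
    rw [subgroupZeta, ← Subtype.val_injective.tsum_eq
      (g := fun H : {H : AddSubgroup M // ∃ a, H.index = p ^ a} => H.1)]
    · exact tsum_congr fun H => if_pos H.2
    · intro H hH
      by_contra h
      exact hH (primePowWeight_of_not fun h' => h ⟨⟨H, h'⟩, rfl⟩)
  rw [h1, ← (Equiv.sigmaFiberEquiv (ofQuotient.{v} (M := M) hp)).tsum_eq, ENNReal.tsum_sigma']
  refine tsum_congr fun G => ?_
  rw [← ENat.card_congr (ofQuotientFiberEquiv hp G), ← ENNReal.tsum_const]
  refine tsum_congr fun H => ?_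
  obtain ⟨e⟩ := (ofQuotient_eq_iff hp H.1 G).1 H.2
  have h : H.1.1.index = G.order := by
    rw [order_eq_card_rep]
    exact Nat.card_congr e.toEquiv
  rw [← h]
  rfl

theorem tsum_surjectiveDensity {p : ℕ} (hp : p.Prime) (u k : ℕ) :
    ∑' G : FinAbPGroupClass.{v} p, ((G.order : ℝ≥0∞) ^ u * (G.cardAut : ℝ≥0∞))⁻¹ *
      AddMonoidHom.surjectiveDensity G.Rep k =
      ∏ j ∈ Finset.range k, (1 - (p : ℝ≥0∞)⁻¹ ^ (u + 1 + j))⁻¹ := by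
  have hp0 : (p : ℝ≥0∞) ≠ 0 := Nat.cast_ne_zero.2 hp.ne_zero
  have hprod : ∏ j ∈ Finset.range k, (1 - (p : ℝ≥0∞)⁻¹ ^ (u + 1 + j))⁻¹ =
      subgroupZeta p (k + u) (Fin k → ℤ) := by
    rw [subgroupZeta_pi_int hp, ← Finset.prod_range_reflect]
    refine Finset.prod_congr rfl fun i hi => ?_
    have hi := Finset.mem_range.1 hi
    -- The factor `p ^ i` cancels part of `p ^ (-(k + u))`; reflecting `i` to `k - 1 - i` turns the
    -- remaining exponents into `u + 1, …, u + k`.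
    have he : k + u = i + (u + 1 + (k - 1 - i)) := by omega
    rw [he, pow_add _ i, ← mul_assoc, ← mul_pow,
      ENNReal.mul_inv_cancel hp0 (ENNReal.natCast_ne_top p), one_pow, one_mul]
  rw [hprod, subgroupZeta_eq_tsum_class.{v} hp]
  refine tsum_congr fun G => ?_
  have hA0 : (G.cardAut : ℝ≥0∞) ≠ 0 := Nat.cast_ne_zero.2 G.cardAut_pos.ne'
  have hAt : (G.cardAut : ℝ≥0∞) ≠ ∞ := ENNReal.natCast_ne_top _
  have := AddMonoidHom.finite_pi_int G.Rep k
  have : Nonempty (G.Rep ≃+ G.Rep) := ⟨AddEquiv.refl _⟩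
  -- Subgroups with quotient `G` embed into the finite set of surjections, as their kernels.
  have : Finite {H : AddSubgroup (Fin k → ℤ) // Nonempty ((Fin k → ℤ) ⧸ H ≃+ G.Rep)} :=
    Finite.of_injective
      (fun H => AddMonoidHom.sigmaQuotientEquivSurjective (Fin k → ℤ) G.Rep ⟨H, H.2.some⟩)
      fun H H' h => congrArg Sigma.fst ((AddMonoidHom.sigmaQuotientEquivSurjective _ _).injective h)
  rw [AddMonoidHom.surjectiveDensity, AddMonoidHom.card_surjective_eq, ← G.cardAut_eq_card_rep,
    ← G.order_eq_card_rep, ENat.card_eq_coe_natCard, ENNReal.mul_inv (Or.inr hAt) (Or.inr hA0),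
    ENNReal.inv_pow, pow_add]
  generalize Nat.card {H : AddSubgroup (Fin k → ℤ) // Nonempty ((Fin k → ℤ) ⧸ H ≃+ G.Rep)} = N
  push_cast
  calc _ = (G.order : ℝ≥0∞)⁻¹ ^ u * (N * (G.order : ℝ≥0∞)⁻¹ ^ k) *
        (G.cardAut * (G.cardAut : ℝ≥0∞)⁻¹) := by ring
    _ = _ := by
        rw [ENNReal.mul_inv_cancel hA0 hAt, mul_one]
        ring

/-! ### Convergence and passage to the limit -/

/-- With `y = x ^ (-(u + 1 + k))`, one has `(1 - y)⁻¹ - 1 = y (1 - y)⁻¹`, dominated by a geometric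
series. -/
theorem multipliable_inv_one_sub_one_div_pow {x : ℝ} (hx : 1 < x) (u : ℕ) :
    Multipliable fun k : ℕ => (1 - 1 / x ^ (u + 1 + k))⁻¹ := by
  have hx0 : 0 < x := one_pos.trans hx
  have hlt (k : ℕ) : 1 / x ^ (u + 1 + k) ≤ 1 / x := by
    gcongr
    exact le_self_pow₀ hx.le (by omega)
  have hx1 : 1 / x < 1 := (div_lt_one hx0).2 hx
  have hs : Summable fun k : ℕ => (1 - 1 / x ^ (u + 1 + k))⁻¹ - 1 := by
    have hg : Summable fun k : ℕ => (1 - 1 / x)⁻¹ * (1 / x) ^ k :=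
      (summable_geometric_of_lt_one (by positivity) hx1).mul_left _
    refine Summable.of_nonneg_of_le (fun k => ?_) (fun k => ?_) hg
    · rw [sub_nonneg]
      refine one_le_inv_iff₀.2 ⟨by linarith [hlt k], ?_⟩
      have : 0 < 1 / x ^ (u + 1 + k) := by positivity
      linarith
    · have h1 : 0 < 1 - 1 / x ^ (u + 1 + k) := by linarith [hlt k]
      have h2 : (1 - 1 / x ^ (u + 1 + k))⁻¹ - 1 =
          (1 - 1 / x ^ (u + 1 + k))⁻¹ * (1 / x ^ (u + 1 + k)) := by
        have := h1.ne'
        generalize 1 / x ^ (u + 1 + k) = y at *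
        field_simp
        ring
      rw [h2]
      have h3 : 1 / x ^ (u + 1 + k) ≤ (1 / x) ^ k := by
        rw [one_div_pow]
        gcongr
        · exact hx.le
        · omega
      have h4 : 0 < 1 - 1 / x := by linarith
      gcongr
      exact le_self_pow₀ hx.le (by omega)
  simpa using Real.multipliable_one_add_of_summable hs

theorem theorem1 (p : ℕ) (hp : p.Prime) (u : ℕ) :
    Summable (fun G : FinAbPGroupClass.{v} p =>
      1 / ((G.order : ℝ) ^ u * (G.cardAut : ℝ))) ∧
    Multipliable (fun k : ℕ => (1 - 1 / (p : ℝ) ^ (u + 1 + k))⁻¹) ∧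
    ∑' G : FinAbPGroupClass.{v} p, 1 / ((G.order : ℝ) ^ u * (G.cardAut : ℝ)) =
      ∏' k : ℕ, (1 - 1 / (p : ℝ) ^ (u + 1 + k))⁻¹ := by
  have hp1 : (1 : ℝ) < p := by exact_mod_cast hp.one_lt
  have hp0 : (0 : ℝ) < p := one_pos.trans hp1
  have hmul := multipliable_inv_one_sub_one_div_pow hp1 u
  set f : FinAbPGroupClass.{v} p → ℝ := fun G => 1 / ((G.order : ℝ) ^ u * (G.cardAut : ℝ)) with hf
  set g : ℕ → ℝ := fun k => (1 - 1 / (p : ℝ) ^ (u + 1 + k))⁻¹ with hg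
  have hf0 (G : FinAbPGroupClass.{v} p) : 0 ≤ f G := by positivity
  have hpos (k : ℕ) : 0 < 1 - 1 / (p : ℝ) ^ (u + 1 + k) := by
    rw [sub_pos, div_lt_one (by positivity)]
    exact one_lt_pow₀ hp1 (by omega)
  have hg0 (k : ℕ) : 0 ≤ g k := (inv_pos.2 (hpos k)).le
  have hfe (G : FinAbPGroupClass.{v} p) :
      ENNReal.ofReal (f G) = ((G.order : ℝ≥0∞) ^ u * (G.cardAut : ℝ≥0∞))⁻¹ := by
    have ho := G.order_pos
    have ha := G.cardAut_pos
    simp only [hf]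
    rw [one_div, ENNReal.ofReal_inv_of_pos (by positivity), ENNReal.ofReal_mul (by positivity),
      ENNReal.ofReal_pow (by positivity), ENNReal.ofReal_natCast, ENNReal.ofReal_natCast]
  have hge (k : ℕ) : ENNReal.ofReal (g k) = (1 - (p : ℝ≥0∞)⁻¹ ^ (u + 1 + k))⁻¹ := by
    simp only [hg]
    rw [ENNReal.ofReal_inv_of_pos (hpos k), ENNReal.ofReal_sub _ (by positivity),
      ENNReal.ofReal_one, one_div, ENNReal.ofReal_inv_of_pos (by positivity),
      ENNReal.ofReal_pow hp0.le, ENNReal.ofReal_natCast, ENNReal.inv_pow]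
  have hk (k : ℕ) : ∑' G : FinAbPGroupClass.{v} p, ENNReal.ofReal (f G) *
      AddMonoidHom.surjectiveDensity G.Rep k = ENNReal.ofReal (∏ j ∈ Finset.range k, g j) := by
    rw [ENNReal.ofReal_prod_of_nonneg fun j _ => hg0 j]
    simp_rw [hfe, hge]
    exact tsum_surjectiveDensity hp u k
  have hlim : Tendsto (fun k => ENNReal.ofReal (∏ j ∈ Finset.range k, g j)) atTop
      (𝓝 (ENNReal.ofReal (∏' k, g k))) :=
    ENNReal.tendsto_ofReal hmul.hasProd.tendsto_prod_nat
  have hsum : ∑' G, ENNReal.ofReal (f G) = ENNReal.ofReal (∏' k, g k) := by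
    apply le_antisymm
    -- On a finite set of classes the densities tend to 1 termwise, and each finite sum is bounded
    -- by the `k`-th partial product.
    · rw [ENNReal.tsum_eq_iSup_sum]
      refine iSup_le fun F => ?_
      have hF : Tendsto (fun k => ∑ G ∈ F, ENNReal.ofReal (f G) *
          AddMonoidHom.surjectiveDensity G.Rep k) atTop (𝓝 (∑ G ∈ F, ENNReal.ofReal (f G))) := by
        refine tendsto_finsetSum _ fun G _ => ?_
        simpa using ENNReal.Tendsto.const_mul (AddMonoidHom.tendsto_surjectiveDensity G.Rep)
          (Or.inr ENNReal.ofReal_ne_top)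
      refine le_of_tendsto_of_tendsto' hF hlim fun k => ?_
      rw [← hk]
      exact ENNReal.sum_le_tsum F
    -- Conversely, density at most 1 bounds every partial product by the full series.
    · refine le_of_tendsto' hlim fun k => ?_
      rw [← hk]
      exact ENNReal.tsum_le_tsum fun G =>
        mul_le_of_le_one_right' (AddMonoidHom.surjectiveDensity_le_one G.Rep k)
  have hprod0 : 0 ≤ ∏' k, g k :=
    ge_of_tendsto' hmul.hasProd.tendsto_prod_nat fun k => Finset.prod_nonneg fun j _ => hg0 j
  -- Summability comes from the identity itself: the sum in `ℝ≥0∞` equals a finite product.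
  have hsummable : Summable f := by
    have h : ∑' G, ENNReal.ofReal (f G) ≠ ∞ := by
      rw [hsum]
      exact ENNReal.ofReal_ne_top
    refine (ENNReal.summable_toReal h).congr fun G => ?_
    exact ENNReal.toReal_ofReal (hf0 G)
  refine ⟨hsummable, hmul, ?_⟩
  rw [← ENNReal.ofReal_tsum_of_nonneg hf0 hsummable] at hsum
  exact (ENNReal.ofReal_eq_ofReal_iff (tsum_nonneg hf0) hprod0).1 hsum
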